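/- **Terms.** Fix a set $\mathcal K_+$ of positive instructions and a set $\mathcal K_-$ of negative instructions. Positive variables are written $x,y,\dots$, negative variables $\alpha,\beta,\dots$, and $\kappa,\kappa'$ stand for variables of either polarity. Values, terms and commands, taken modulo $\alpha$-equivalence, are given by $$V ::= V_+ \mid t_-,\qquad V_+ ::= x \mid (V,V') \mid \{V\} \mid k_+,\qquad t_+ ::= V_+ \mid \mu\alpha.c,$$ $$t_- ::= \alpha \mid \mu(\kappa,\kappa').c \mid \mu\{\kappa\}.c \mid \mu x.c \mid k_-,\qquad t ::= t_+\mid t_-,\qquad c ::= \langle t_+\mid t_-\rangle ,$$ where $k_\pm\in\mathcal K_\pm$, $\kappa\neq\kappa'$ in $\mu(\kappa,\kappa').c$, and $\langle t\mid u\rangle$ is identified with $\langle u\mid t\rangle$. The size $|c|$ is the number of occurrences in $c$ of variables, instructions, pairs $(\cdot,\cdot)$, one-tuples $\{\cdot\}$ and $\mu$-binders (bound variables next to their binder and the cuts $\langle\cdot\mid\cdot\rangle$ are not counted). **Reduction.** On commands let $$\langle\mu\alpha.c\mid t_-\rangle\to_\mu c[t_- /\alpha],\qquad \langle V_+\mid\mu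 x.c\rangle\to_\mu c[V_+/x],$$ $$\langle\{V\}\mid\mu\{\kappa\}.c\rangle\to_\beta c[V/\kappa],\qquad \langle(V,V')\mid\mu(\kappa,\kappa').c\rangle\to_\beta c[V/\kappa,V'/\kappa'],$$ the last two only when the polarities of the variables and of the values match, and let ${\to_0}={\to_\beta}\cup{\to_\mu}$ (no reduction inside subterms). **Formulas of MAL$\omega$.** Kinds are $\sigma,\tau ::= \iota\mid o^+\mid o^-\mid\sigma\to\tau$. Constructors, modulo $\alpha$-equivalence, are $$T,U,A,B ::= x^\tau\mid (x^{\tau})^\bot\mid\lambda x^\tau.T\mid TU\mid \mathbf 0\mid\mathbf s\mid rec_\tau\mid rec_\tau^\bot\mid A\otimes B\mid A⅋ B\mid\exists x^\tau.A\mid\forall x^\tau.A\mid{\downarrow}A\mid{\uparrow}A .$$ Negation is the involution with $(o^\pm)^\bot=o^\mp$, $\iota^\bot=\iota$, $(\sigma\to\tau)^\bot=\sigma\to\tau^\bot$ on kinds. On constructors it exchanges $x^\tau$ and $(x^\tau)^\bot$, $rec_\tau$ and $rec_\tau^\bot$, $\otimes$ and $⅋$, $\exists$ and $\forall$, $\downarrow$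 and $\uparrow$ (negating the formulas below these connectives), fixes $\mathbf 0$ and $\mathbf s$, and satisfies $(\lambda x^\tau.T)^\bot=\lambda x^\tau.T^\bot$ and $(TU)^\bot=T^\bot U$. Substituting $U$ for $x^\tau$ replaces $(x^\tau)^\bot$ by $U^\bot$. Kinding $T:\tau$ is given by: $x^\tau:\tau$; $(x^\tau)^\bot:\tau^\bot$; the usual rules for $\lambda$ and application; $\mathbf 0:\iota$; $\mathbf s:\iota\to\iota$; $rec_\tau:\tau\to(\iota\to\tau\to\tau)\to\iota\to\tau$; $rec_\tau^\bot:\tau\to(\iota\to\tau\to\tau)\to\iota\to\tau^\bot$; for $A,B$ of kind $o^+$ or $o^-$, $A\otimes B,{\downarrow}A:o^+$ and $A⅋B,{\uparrow}A:o^-$; and $\forall x^\tau.A,\ \exists x^\tau.A$ have the kind of $A$ (either $o^+$ or $o^-$). Convertibility $\cong$ is the congruence generated by $\beta$, $\eta$ and $$rec_\tau\,T\,U\,\mathbf 0\cong T,\quad rec_\tau\,T\,U\,(\mathbf s\,n)\cong U\,n\,(rec_\tau\,T\,U\,n),\quad rec^\bot_\tau\,T\,U\,\mathbf 0\cong T^\bot,\quad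 rec^\bot_\tau\,T\,U\,(\mathbf s\,n)\cong U^\bot\,n\,(rec_\tau\,T\,U\,n).$$ **Typing rules of MAL$\omega$.** Formulas are the constructors of kind $o^+$ (positive, $P$) or $o^-$ (negative, $N$). A context is a finite set of declarations $x:N$ and $\alpha:P$, each variable being declared at most once; $\Gamma,\Delta$ denotes the union of two contexts without common variables. The judgments are $\vdash t_+:P\mid\Gamma$, $\ \vdash t_-:N\mid\Gamma$ and $c:(\vdash\Gamma)$. All formulas in judgments are well-kinded and of the required polarity. The rules are: * (Ax) $\vdash x:P\mid x:P^\bot$ and $\vdash\alpha:N\mid\alpha:N^\bot$; * ($\mu$) from $c:(\vdash\alpha:P,\Gamma)$ infer $\vdash\mu\alpha.c:P\mid\Gamma$; from $c:(\vdash x:N,\Gamma)$ infer $\vdash\mu x.c:N\mid\Gamma$; * (Cut) from $\vdash t:A\mid\Gamma$ and $\vdash u:A^\bot\mid\Delta$ infer $\langle t\mid u\rangle:(\vdash\Gamma,\Delta)$; * ($\otimes$) from $\vdash V:A\mid\Gamma$ and $\vdash V':B\mid\Delta$ infer $\vdash(V,V'):A\otimes B\mid\Gamma,\Delta$; * ($⅋$)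 from $c:(\vdash\kappa:A,\kappa':B,\Gamma)$ infer $\vdash\mu(\kappa,\kappa').c:A⅋B\mid\Gamma$; * ($\downarrow$) from $\vdash V:A\mid\Gamma$ infer $\vdash\{V\}:{\downarrow}A\mid\Gamma$; * ($\uparrow$) from $c:(\vdash\kappa:A,\Gamma)$ infer $\vdash\mu\{\kappa\}.c:{\uparrow}A\mid\Gamma$; * ($\exists$) from $T:\tau$ and $\vdash t:A[T/x^\tau]\mid\Gamma$ infer $\vdash t:\exists x^\tau.A\mid\Gamma$; * ($\forall$) from $\vdash V:A\mid\Gamma$ with $x^\tau$ not free in $\Gamma$ infer $\vdash V:\forall x^\tau.A\mid\Gamma$; * ($\cong$) from $c:(\vdash\kappa:A,\Gamma)$ and $A\cong B$ infer $c:(\vdash\kappa:B,\Gamma)$; * (W) from $c:(\vdash\Gamma)$ infer $c:(\vdash\kappa:A,\Gamma)$. **Theorem.** If $c:(\vdash\Gamma)$ is derivable in MAL$\omega$ for some context $\Gamma$, then $c$ normalizes for $\to_0$ using at most $|c|$ $\to_\beta$-steps. That is, there is no infinite $\to_0$-reduction sequence from $c$, $c$ reduces to a $\to_0$-normal command, and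 every $\to_0$-reduction sequence from $c$ (in particular the one that reaches the normal form) contains at most $|c|$ $\to_\beta$-steps. -/

import Mathlib

namespace MALOmega

/-! ## Polarities, kinds and type constructors -/

/-- The two polarities. -/
inductive Pol where
  | pos
  | neg
  deriving DecidableEq

/-- The opposite polarity. -/
def Pol.dual : Pol → Pol
  | .pos => .neg
  | .neg => .pos

/-- Kinds: individuals `ι`, formulas `o⁺` and `o⁻`, and functions. -/
inductive Knd where
  | ind : Knd
  | form (p : Pol) : Knd
  | arr (σ τ : Knd) : Knd
  deriving DecidableEq

/-- Negation of kinds: it exchanges `o⁺` and `o⁻` in the target position. -/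
def Knd.dual : Knd → Knd
  | .ind => .ind
  | .form p => .form p.dual
  | .arr σ τ => .arr σ τ.dual

/-- Type constructors modulo `α`-equivalence. The variables of each kind `τ` form their own
countably infinite supply `x₀^τ, x₁^τ, …`; they are represented by de Bruijn indices that are
counted separately for each kind: a binder of kind `τ` captures index `0` among the variables of
kind `τ`, and leaves the variables of the other kinds alone. `dvar τ i` is the dual variable
`(x_i^τ)^⊥`, which is bound by the same binder as `x_i^τ`. -/
inductive Con where
  | var (τ : Knd) (i : ℕ) : Con
  | dvar (τ : Knd) (i : ℕ) : Con
  | lam (τ : Knd) (T : Con) : Con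
  | app (T U : Con) : Con
  | zero : Con
  | succ : Con
  | recur (τ : Knd) : Con
  | drecur (τ : Knd) : Con
  | tensor (A B : Con) : Con
  | par (A B : Con) : Con
  | ex (τ : Knd) (A : Con) : Con
  | all (τ : Knd) (A : Con) : Con
  | down (A : Con) : Con
  | up (A : Con) : Con

namespace Con

/-- The involutive negation `T^⊥`. -/
def dual : Con → Con
  | var τ i => dvar τ i
  | dvar τ i => var τ i
  | lam τ T => lam τ T.dual
  | app T U => app T.dual U
  | zero => zero
  | succ => succ
  | recur τ => drecur τ
  | drecur τ => recur τ
  | tensor A B => par A.dual B.dual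
  | par A B => tensor A.dual B.dual
  | ex τ A => all τ A.dual
  | all τ A => ex τ A.dual
  | down A => up A.dual
  | up A => down A.dual

/-- Passage of a renaming of constructor variables under a binder of kind `τ`. -/
def upRen (τ : Knd) (ξ : Knd → ℕ → ℕ) : Knd → ℕ → ℕ :=
  fun σ i => if σ = τ then (match i with | 0 => 0 | j + 1 => ξ σ j + 1) else ξ σ i

/-- Renaming of the free variables. -/
def rename : Con → (Knd → ℕ → ℕ) → Con
  | var τ i, ξ => var τ (ξ τ i)
  | dvar τ i, ξ => dvar τ (ξ τ i)
  | lam τ T, ξ => lam τ (T.rename (upRen τ ξ))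
  | app T U, ξ => app (T.rename ξ) (U.rename ξ)
  | zero, _ => zero
  | succ, _ => succ
  | recur τ, _ => recur τ
  | drecur τ, _ => drecur τ
  | tensor A B, ξ => tensor (A.rename ξ) (B.rename ξ)
  | par A B, ξ => par (A.rename ξ) (B.rename ξ)
  | ex τ A, ξ => ex τ (A.rename (upRen τ ξ))
  | all τ A, ξ => all τ (A.rename (upRen τ ξ))
  | down A, ξ => down (A.rename ξ)
  | up A, ξ => up (A.rename ξ)

/-- Weakening by a variable of kind `τ`: the result does not contain `x₀^τ`. -/
def shift (τ : Knd) (T : Con) : Con :=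
  T.rename (fun σ i => if σ = τ then i + 1 else i)

/-- Passage of a substitution under a binder of kind `τ`. -/
def upSub (τ : Knd) (s : Knd → ℕ → Con) : Knd → ℕ → Con :=
  fun σ i =>
    if σ = τ then (match i with | 0 => var σ 0 | j + 1 => shift τ (s σ j)) else shift τ (s σ i)

/-- Capture-avoiding simultaneous substitution; a dual variable is replaced by the negation of
the constructor that is substituted for the variable. -/
def subst : Con → (Knd → ℕ → Con) → Con
  | var τ i, s => s τ i
  | dvar τ i, s => (s τ i).dual
  | lam τ T, s => lam τ (T.subst (upSub τ s))
  | app T U, s => app (T.subst s) (U.subst s)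
  | zero, _ => zero
  | succ, _ => succ
  | recur τ, _ => recur τ
  | drecur τ, _ => drecur τ
  | tensor A B, s => tensor (A.subst s) (B.subst s)
  | par A B, s => par (A.subst s) (B.subst s)
  | ex τ A, s => ex τ (A.subst (upSub τ s))
  | all τ A, s => all τ (A.subst (upSub τ s))
  | down A, s => down (A.subst s)
  | up A, s => up (A.subst s)

/-- `T{x^τ := U}`, where `x^τ` is the variable of index `0` of kind `τ` in `T`. -/
def inst (τ : Knd) (T U : Con) : Con :=
  T.subst (fun σ i =>
    if σ = τ then (match i with | 0 => U | j + 1 => var σ j) else var σ i)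

end Con

/-- The kinding judgment `T : τ`. -/
inductive HasKind : Con → Knd → Prop
  | var (τ : Knd) (i : ℕ) : HasKind (.var τ i) τ
  | dvar (τ : Knd) (i : ℕ) : HasKind (.dvar τ i) τ.dual
  | lam {σ τ : Knd} {T : Con} : HasKind T τ → HasKind (.lam σ T) (.arr σ τ)
  | app {σ τ : Knd} {T U : Con} :
      HasKind T (.arr σ τ) → HasKind U σ → HasKind (.app T U) τ
  | zero : HasKind .zero .ind
  | succ : HasKind .succ (.arr .ind .ind)
  | recur (τ : Knd) :
      HasKind (.recur τ) (.arr τ (.arr (.arr .ind (.arr τ τ)) (.arr .ind τ)))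
  | drecur (τ : Knd) :
      HasKind (.drecur τ) (.arr τ (.arr (.arr .ind (.arr τ τ)) (.arr .ind τ.dual)))
  | tensor {p q : Pol} {A B : Con} :
      HasKind A (.form p) → HasKind B (.form q) → HasKind (.tensor A B) (.form .pos)
  | par {p q : Pol} {A B : Con} :
      HasKind A (.form p) → HasKind B (.form q) → HasKind (.par A B) (.form .neg)
  | down {p : Pol} {A : Con} : HasKind A (.form p) → HasKind (.down A) (.form .pos)
  | up {p : Pol} {A : Con} : HasKind A (.form p) → HasKind (.up A) (.form .neg)
  | all {τ : Knd} {p : Pol} {A : Con} :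
      HasKind A (.form p) → HasKind (.all τ A) (.form p)
  | ex {τ : Knd} {p : Pol} {A : Con} :
      HasKind A (.form p) → HasKind (.ex τ A) (.form p)

/-- Convertibility `T ≅ T'` of constructors. -/
inductive Conv : Con → Con → Prop
  | beta (τ : Knd) (T U : Con) : Conv (.app (.lam τ T) U) (Con.inst τ T U)
  | eta (τ : Knd) (T : Con) : Conv (.lam τ (.app (Con.shift τ T) (.var τ 0))) T
  | rec_zero (τ : Knd) (T U : Con) :
      Conv (.app (.app (.app (.recur τ) T) U) .zero) T
  | rec_succ (τ : Knd) (T U n : Con) :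
      Conv (.app (.app (.app (.recur τ) T) U) (.app .succ n))
        (.app (.app U n) (.app (.app (.app (.recur τ) T) U) n))
  | drec_zero (τ : Knd) (T U : Con) :
      Conv (.app (.app (.app (.drecur τ) T) U) .zero) T.dual
  | drec_succ (τ : Knd) (T U n : Con) :
      Conv (.app (.app (.app (.drecur τ) T) U) (.app .succ n))
        (.app (.app U.dual n) (.app (.app (.app (.recur τ) T) U) n))
  | refl (T : Con) : Conv T T
  | symm {T T' : Con} : Conv T T' → Conv T' T
  | trans {T T' T'' : Con} : Conv T T' → Conv T' T'' → Conv T T''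
  | lam (τ : Knd) {T T' : Con} : Conv T T' → Conv (.lam τ T) (.lam τ T')
  | app {T T' U U' : Con} : Conv T T' → Conv U U' → Conv (.app T U) (.app T' U')
  | tensor {A A' B B' : Con} : Conv A A' → Conv B B' → Conv (.tensor A B) (.tensor A' B')
  | par {A A' B B' : Con} : Conv A A' → Conv B B' → Conv (.par A B) (.par A' B')
  | ex (τ : Knd) {A A' : Con} : Conv A A' → Conv (.ex τ A) (.ex τ A')
  | all (τ : Knd) {A A' : Con} : Conv A A' → Conv (.all τ A) (.all τ A')
  | down {A A' : Con} : Conv A A' → Conv (.down A) (.down A')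
  | up {A A' : Con} : Conv A A' → Conv (.up A) (.up A')

/-! ## Terms and commands -/

/-- Syntactic categories: values of a given polarity, terms of a given polarity, commands. -/
inductive Cat where
  | val (p : Pol) : Cat
  | tm (p : Pol) : Cat
  | cmd : Cat

/-- Values, terms and commands of the focalising system L modulo `α`-equivalence, with positive
instructions `Kp` and negative instructions `Kn`. Variables are de Bruijn indices that are counted
separately for each polarity: `var .pos i` is a positive variable (`x, y, …`) and `var .neg i` a
negative one (`α, β, …`). Negative terms are exactly the negative values. A command is written
with its positive term first, which takes care of the identification of `⟨t | u⟩` and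
`⟨u | t⟩`. -/
inductive Expr (Kp Kn : Type*) : Cat → Type _
  | var (p : Pol) (i : ℕ) : Expr Kp Kn (.val p)
  /-- the pair `(V, V')` of two values of any polarities -/
  | pair {p q : Pol} (V : Expr Kp Kn (.val p)) (W : Expr Kp Kn (.val q)) : Expr Kp Kn (.val .pos)
  /-- the one-tuple `{V}` of a value of any polarity -/
  | brace {p : Pol} (V : Expr Kp Kn (.val p)) : Expr Kp Kn (.val .pos)
  | kpos (k : Kp) : Expr Kp Kn (.val .pos)
  /-- `μ(κ, κ').c`, with `κ` of polarity `p` bound first (outside) and `κ'` of polarity `q` bound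
  second (inside) -/
  | muPair (p q : Pol) (c : Expr Kp Kn .cmd) : Expr Kp Kn (.val .neg)
  /-- `μ{κ}.c`, with `κ` of polarity `p` -/
  | muBrace (p : Pol) (c : Expr Kp Kn .cmd) : Expr Kp Kn (.val .neg)
  /-- `μx.c`, with `x` positive -/
  | muPos (c : Expr Kp Kn .cmd) : Expr Kp Kn (.val .neg)
  | kneg (k : Kn) : Expr Kp Kn (.val .neg)
  /-- every value is a term of the same polarity -/
  | ofVal {p : Pol} (V : Expr Kp Kn (.val p)) : Expr Kp Kn (.tm p)
  /-- `μα.c`, with `α` negative; the only terms that are not values -/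
  | muNeg (c : Expr Kp Kn .cmd) : Expr Kp Kn (.tm .pos)
  /-- the command `⟨t₊ | t₋⟩` -/
  | cut (t : Expr Kp Kn (.tm .pos)) (u : Expr Kp Kn (.tm .neg)) : Expr Kp Kn .cmd

/-- Values of polarity `p`. -/
abbrev Val (Kp Kn : Type*) (p : Pol) := Expr Kp Kn (.val p)

/-- Terms of polarity `p`. -/
abbrev Tm (Kp Kn : Type*) (p : Pol) := Expr Kp Kn (.tm p)

/-- Commands. -/
abbrev Cmd (Kp Kn : Type*) := Expr Kp Kn .cmd

/-- Passage of a renaming under a binder of polarity `p`. -/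
def upRen (p : Pol) (ξ : Pol → ℕ → ℕ) : Pol → ℕ → ℕ :=
  fun q i => if q = p then (match i with | 0 => 0 | j + 1 => ξ q j + 1) else ξ q i

/-- The size `|e|`: the number of occurrences of variables, instructions, pairs, one-tuples and
`μ`-binders in `e`. -/
def Expr.size {Kp Kn : Type*} : {k : Cat} → Expr Kp Kn k → ℕ
  | _, .var _ _ => 1
  | _, .pair V W => V.size + W.size + 1
  | _, .brace V => V.size + 1
  | _, .kpos _ => 1
  | _, .muPair _ _ c => c.size + 1
  | _, .muBrace _ c => c.size + 1
  | _, .muPos c => c.size + 1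
  | _, .kneg _ => 1
  | _, .ofVal V => V.size
  | _, .muNeg c => c.size + 1
  | _, .cut t u => t.size + u.size

/-- Renaming of the free variables. -/
def Expr.rename {Kp Kn : Type*} : {k : Cat} → Expr Kp Kn k → (Pol → ℕ → ℕ) → Expr Kp Kn k
  | _, .var p i, ξ => .var p (ξ p i)
  | _, .pair V W, ξ => .pair (V.rename ξ) (W.rename ξ)
  | _, .brace V, ξ => .brace (V.rename ξ)
  | _, .kpos k, _ => .kpos k
  | _, .muPair p q c, ξ => .muPair p q (c.rename (upRen q (upRen p ξ)))
  | _, .muBrace p c, ξ => .muBrace p (c.rename (upRen p ξ))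
  | _, .muPos c, ξ => .muPos (c.rename (upRen .pos ξ))
  | _, .kneg k, _ => .kneg k
  | _, .ofVal V, ξ => .ofVal (V.rename ξ)
  | _, .muNeg c, ξ => .muNeg (c.rename (upRen .neg ξ))
  | _, .cut t u, ξ => .cut (t.rename ξ) (u.rename ξ)

/-- Substitutions: each variable is sent to a value of its own polarity. -/
def Sub (Kp Kn : Type*) := (p : Pol) → ℕ → Val Kp Kn p

/-- The identity substitution. -/
def Sub.id (Kp Kn : Type*) : Sub Kp Kn := fun p i => .var p i

/-- The substitution that sends the variable of polarity `p` bound last to `V`, and the others as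
prescribed by `s`. -/
def Sub.cons {Kp Kn : Type*} : {p : Pol} → Val Kp Kn p → Sub Kp Kn → Sub Kp Kn
  | .pos, V, _, .pos, 0 => V
  | .pos, _, s, .pos, i + 1 => s .pos i
  | .pos, _, s, .neg, i => s .neg i
  | .neg, V, _, .neg, 0 => V
  | .neg, _, s, .neg, i + 1 => s .neg i
  | .neg, _, s, .pos, i => s .pos i

/-- Passage of a substitution under a binder of polarity `p`. -/
def Sub.up {Kp Kn : Type*} (p : Pol) (s : Sub Kp Kn) : Sub Kp Kn :=
  Sub.cons (.var p 0)
    (fun q i => (s q i).rename (fun r j => if r = p then j + 1 else j))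

/-- Capture-avoiding simultaneous substitution. -/
def Expr.subst {Kp Kn : Type*} : {k : Cat} → Expr Kp Kn k → Sub Kp Kn → Expr Kp Kn k
  | _, .var p i, s => s p i
  | _, .pair V W, s => .pair (V.subst s) (W.subst s)
  | _, .brace V, s => .brace (V.subst s)
  | _, .kpos k, _ => .kpos k
  | _, .muPair p q c, s => .muPair p q (c.subst ((s.up p).up q))
  | _, .muBrace p c, s => .muBrace p (c.subst (s.up p))
  | _, .muPos c, s => .muPos (c.subst (s.up .pos))
  | _, .kneg k, _ => .kneg k
  | _, .ofVal V, s => .ofVal (V.subst s)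
  | _, .muNeg c, s => .muNeg (c.subst (s.up .neg))
  | _, .cut t u, s => .cut (t.subst s) (u.subst s)

/-! ## Reduction -/

/-- The relation `→_μ` on commands. -/
inductive MuStep {Kp Kn : Type*} : Cmd Kp Kn → Cmd Kp Kn → Prop
  /-- `⟨μα.c | t₋⟩ → c[t₋/α]` -/
  | pos (c : Cmd Kp Kn) (t : Val Kp Kn .neg) :
      MuStep (.cut (.muNeg c) (.ofVal t)) (c.subst (Sub.cons t (Sub.id Kp Kn)))
  /-- `⟨V₊ | μx.c⟩ → c[V₊/x]` -/
  | neg (V : Val Kp Kn .pos) (c : Cmd Kp Kn) :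
      MuStep (.cut (.ofVal V) (.ofVal (.muPos c))) (c.subst (Sub.cons V (Sub.id Kp Kn)))

/-- The relation `→_β` on commands; the polarities of the variables and of the values that are
substituted for them agree. -/
inductive BetaStep {Kp Kn : Type*} : Cmd Kp Kn → Cmd Kp Kn → Prop
  /-- `⟨{V} | μ{κ}.c⟩ → c[V/κ]` -/
  | brace {p : Pol} (V : Val Kp Kn p) (c : Cmd Kp Kn) :
      BetaStep (.cut (.ofVal (.brace V)) (.ofVal (.muBrace p c)))
        (c.subst (Sub.cons V (Sub.id Kp Kn)))
  /-- `⟨(V, V') | μ(κ, κ').c⟩ → c[V/κ, V'/κ']` -/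
  | pair {p q : Pol} (V : Val Kp Kn p) (W : Val Kp Kn q) (c : Cmd Kp Kn) :
      BetaStep (.cut (.ofVal (.pair V W)) (.ofVal (.muPair p q c)))
        (c.subst (Sub.cons W (Sub.cons V (Sub.id Kp Kn))))

/-- The relation `→_0`, the union of `→_β` and `→_μ`. -/
def Step {Kp Kn : Type*} (c d : Cmd Kp Kn) : Prop := BetaStep c d ∨ MuStep c d

/-- `Reduces n c d`: there is a `→_0`-reduction sequence from `c` to `d` with exactly `n`
`→_β`-steps and any number of `→_μ`-steps. -/
inductive Reduces {Kp Kn : Type*} : ℕ → Cmd Kp Kn → Cmd Kp Kn → Prop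
  | refl (c : Cmd Kp Kn) : Reduces 0 c c
  | beta {n : ℕ} {c d e : Cmd Kp Kn} : BetaStep c d → Reduces n d e → Reduces (n + 1) c e
  | mu {n : ℕ} {c d e : Cmd Kp Kn} : MuStep c d → Reduces n d e → Reduces n c e

/-- `c` is normal for `→_0`. -/
def IsNormal {Kp Kn : Type*} (c : Cmd Kp Kn) : Prop := ∀ d, ¬ Step c d

/-- `c` is strongly normalizing for `→_0`: no infinite reduction sequence starts from `c`. -/
def StronglyNormalizing {Kp Kn : Type*} (c : Cmd Kp Kn) : Prop :=
  Acc (fun d e : Cmd Kp Kn => Step e d) c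

/-! ## The type system -/

/-- Typing contexts: each variable occurs at most once, and `Γ p i = some A` means that the
variable `var p i` is declared with the formula `A`. The contexts of derivable judgments are
automatically finite, and declare positive variables with negative formulas and negative variables
with positive formulas. -/
def Ctx := Pol → ℕ → Option Con

/-- The empty context. -/
def Ctx.empty : Ctx := fun _ _ => none

/-- The context `κ : A, Γ`, where `κ` is the variable `var p i`. -/
def Ctx.set (Γ : Ctx) (p : Pol) (i : ℕ) (A : Con) : Ctx :=
  fun q j => if q = p ∧ j = i then some A else Γ q j

/-- The context `κ : A, Γ` for the body of a binder of the variable `κ` of polarity `p`. -/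
def Ctx.push (Γ : Ctx) (p : Pol) (A : Con) : Ctx :=
  fun q j => if q = p then (match j with | 0 => some A | i + 1 => Γ q i) else Γ q j

/-- No variable is declared in both contexts. -/
def Ctx.Disj (Γ Δ : Ctx) : Prop := ∀ p i, Γ p i = none ∨ Δ p i = none

/-- The context `Γ, Δ` (used for contexts without common variables). -/
def Ctx.append (Γ Δ : Ctx) : Ctx := fun p i => (Γ p i).or (Δ p i)

/-- Weakening of the formulas of a context by a constructor variable of kind `τ`. -/
def Ctx.shift (τ : Knd) (Γ : Ctx) : Ctx := fun p i => (Γ p i).map (Con.shift τ)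

/-- Typing judgments `⊢ t : A | Γ` and `c : (⊢ Γ)`. -/
inductive Judgment (Kp Kn : Type*)
  | tm {p : Pol} (t : Tm Kp Kn p) (A : Con) (Γ : Ctx) : Judgment Kp Kn
  | cmd (c : Cmd Kp Kn) (Γ : Ctx) : Judgment Kp Kn

/-- Derivability in the system MALω. -/
inductive Derivable {Kp Kn : Type*} : Judgment Kp Kn → Prop
  /-- `(Ax₊)` and `(Ax₋)`: `⊢ κ : A | κ : A^⊥`, with `A` of the polarity of `κ` -/
  | ax (p : Pol) (i : ℕ) {A : Con} : HasKind A (.form p) →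
      Derivable (.tm (.ofVal (.var p i)) A (Ctx.empty.set p i A.dual))
  /-- `(μ₊)` -/
  | muNeg {c : Cmd Kp Kn} {P : Con} {Γ : Ctx} :
      Derivable (.cmd c (Γ.push .neg P)) → Derivable (.tm (.muNeg c) P Γ)
  /-- `(μ₋)` -/
  | muPos {c : Cmd Kp Kn} {N : Con} {Γ : Ctx} :
      Derivable (.cmd c (Γ.push .pos N)) → Derivable (.tm (.ofVal (.muPos c)) N Γ)
  /-- `(Cut)` -/
  | cut {t : Tm Kp Kn .pos} {u : Tm Kp Kn .neg} {A : Con} {Γ Δ : Ctx} :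
      Γ.Disj Δ → Derivable (.tm t A Γ) → Derivable (.tm u A.dual Δ) →
      Derivable (.cmd (.cut t u) (Γ.append Δ))
  /-- `(⊗)` -/
  | tensor {p q : Pol} {V : Val Kp Kn p} {W : Val Kp Kn q} {A B : Con} {Γ Δ : Ctx} :
      Γ.Disj Δ → Derivable (.tm (.ofVal V) A Γ) → Derivable (.tm (.ofVal W) B Δ) →
      Derivable (.tm (.ofVal (.pair V W)) (.tensor A B) (Γ.append Δ))
  /-- `(⅋)` -/
  | par {p q : Pol} {c : Cmd Kp Kn} {A B : Con} {Γ : Ctx} :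
      Derivable (.cmd c ((Γ.push p A).push q B)) →
      Derivable (.tm (.ofVal (.muPair p q c)) (.par A B) Γ)
  /-- `(↓)` -/
  | down {p : Pol} {V : Val Kp Kn p} {A : Con} {Γ : Ctx} :
      Derivable (.tm (.ofVal V) A Γ) → Derivable (.tm (.ofVal (.brace V)) (.down A) Γ)
  /-- `(↑)` -/
  | up {p : Pol} {c : Cmd Kp Kn} {A : Con} {Γ : Ctx} :
      Derivable (.cmd c (Γ.push p A)) → Derivable (.tm (.ofVal (.muBrace p c)) (.up A) Γ)
  /-- `(∃)` -/
  | ex {p : Pol} {t : Tm Kp Kn p} {τ : Knd} {A T : Con} {Γ : Ctx} :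
      HasKind A (.form p) → HasKind T τ → Derivable (.tm t (Con.inst τ A T) Γ) →
      Derivable (.tm t (.ex τ A) Γ)
  /-- `(∀)`, for values only; the bound variable does not appear in `Γ` -/
  | all {p : Pol} {V : Val Kp Kn p} {τ : Knd} {A : Con} {Γ : Ctx} :
      Derivable (.tm (.ofVal V) A (Γ.shift τ)) → Derivable (.tm (.ofVal V) (.all τ A) Γ)
  /-- `(≅)`; `B` is a formula of the polarity required of a declaration of `κ` -/
  | conv {c : Cmd Kp Kn} {p : Pol} {i : ℕ} {A B : Con} {Γ : Ctx} :
      HasKind B (.form p.dual) → Conv A B → Derivable (.cmd c (Γ.set p i A)) →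
      Derivable (.cmd c (Γ.set p i B))
  /-- `(W)`, for a fresh variable of any polarity -/
  | weak {c : Cmd Kp Kn} {p : Pol} {i : ℕ} {A : Con} {Γ : Ctx} :
      HasKind A (.form p.dual) → Γ p i = none → Derivable (.cmd c Γ) →
      Derivable (.cmd c (Γ.set p i A))

end MALOmega

namespace MALOmega

/-! The system has no contraction: cuts and pairs join disjoint contexts, so in a typable command
every variable, free or bound, occurs at most once (`Derivable.affine`). Replacing a variable that
occurs at most once by `V` adds at most `|V| - 1` to the size, while the redex loses its binder and
the separate copy of `V`. Every `→_β`- or `→_μ`-step therefore strictly decreases the size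
(`Step.size_lt`), which gives both termination and the bound.

Subject reduction is not needed. The property carried along a reduction is `BindersAffine`, which is
purely syntactic, concerns bound variables only, and is stable under substitution; formulas and
convertibility play no role in it.

Sizes and occurrence counts are both instances of one function, `Expr.weight`: it is linear in the
weights (`weight_add`, `weight_mul`) and turns substitution into a change of weights
(`weight_subst`). -/

variable {Kp Kn : Type*}

/-! ### Weights of expressions: linearity, renaming and substitution. -/

/-- Passage of a weighting of the variables under a binder of polarity `p`: the new variable gets
weight `a`. -/
def pushWeight (p : Pol) (a : ℕ) (v : Pol → ℕ → ℕ) : Pol → ℕ → ℕ :=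
  fun q i => if q = p then (match i with | 0 => a | j + 1 => v q j) else v q i

/-- The total weight of an expression in which the occurrences of a free variable `var p i` weigh
`v p i`, while the other nodes and the occurrences of bound variables weigh `a`. -/
def Expr.weight (a : ℕ) : {k : Cat} → Expr Kp Kn k → (Pol → ℕ → ℕ) → ℕ
  | _, .var p i, v => v p i
  | _, .pair V W, v => V.weight a v + W.weight a v + a
  | _, .brace V, v => V.weight a v + a
  | _, .kpos _, _ => a
  | _, .muPair p q c, v => c.weight a (pushWeight q a (pushWeight p a v)) + a
  | _, .muBrace p c, v => c.weight a (pushWeight p a v) + a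
  | _, .muPos c, v => c.weight a (pushWeight .pos a v) + a
  | _, .kneg _, _ => a
  | _, .ofVal V, v => V.weight a v
  | _, .muNeg c, v => c.weight a (pushWeight .neg a v) + a
  | _, .cut t u, v => t.weight a v + u.weight a v

/-- The weighting that counts the occurrences of `var p i`. -/
def single (p : Pol) (i : ℕ) : Pol → ℕ → ℕ := fun q j => if q = p ∧ j = i then 1 else 0

theorem pushWeight_const (p : Pol) (a : ℕ) : pushWeight p a (fun _ _ => a) = fun _ _ => a := by
  funext q i
  cases i <;> simp [pushWeight]

theorem pushWeight_add (p : Pol) (a b : ℕ) (v w : Pol → ℕ → ℕ) :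
    pushWeight p (a + b) (fun q i => v q i + w q i) =
      fun q i => pushWeight p a v q i + pushWeight p b w q i := by
  funext q i
  cases i <;> simp only [pushWeight] <;> split <;> rfl

theorem pushWeight_mul (p : Pol) (k a : ℕ) (v : Pol → ℕ → ℕ) :
    pushWeight p (k * a) (fun q i => k * v q i) = fun q i => k * pushWeight p a v q i := by
  funext q i
  cases i <;> simp only [pushWeight] <;> split <;> rfl

theorem pushWeight_upRen (p : Pol) (a : ℕ) (v : Pol → ℕ → ℕ) (ξ : Pol → ℕ → ℕ) :
    (fun q i => pushWeight p a v q (upRen p ξ q i)) = pushWeight p a (fun q i => v q (ξ q i)) := by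
  funext q i
  cases i <;> by_cases h : q = p <;> simp [pushWeight, upRen, h]

theorem pushWeight_shift (p : Pol) (a : ℕ) (v : Pol → ℕ → ℕ) :
    (fun q i => pushWeight p a v q (if q = p then i + 1 else i)) = v := by
  funext q i
  by_cases h : q = p <;> simp [pushWeight, h]

/-- With weight `0` on the new variable, counting an outer variable below a binder means counting
its shifted index. -/
theorem pushWeight_zero_single (p q : Pol) (i : ℕ) :
    pushWeight p 0 (single q i) = single q (if q = p then i + 1 else i) := by
  funext r j
  cases j <;> by_cases h : r = p <;> by_cases h' : q = p <;> simp [pushWeight, single, h, h'] <;>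
    grind

theorem pushWeight_one_zero (p : Pol) : pushWeight p 1 (fun _ _ => 0) = single p 0 := by
  funext r j
  cases j <;> by_cases h : r = p <;> simp [pushWeight, single, h]

namespace Expr

theorem weight_one {k : Cat} (e : Expr Kp Kn k) : e.weight 1 (fun _ _ => 1) = e.size := by
  induction e <;> simp_all [weight, size, pushWeight_const]

theorem weight_zero {k : Cat} (e : Expr Kp Kn k) : e.weight 0 (fun _ _ => 0) = 0 := by
  induction e <;> simp_all [weight, pushWeight_const]

theorem weight_add {k : Cat} (e : Expr Kp Kn k) (a b : ℕ) (v w : Pol → ℕ → ℕ) :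
    e.weight (a + b) (fun q i => v q i + w q i) = e.weight a v + e.weight b w := by
  induction e generalizing v w <;> simp_all only [weight, pushWeight_add] <;> omega

theorem weight_mul {k : Cat} (e : Expr Kp Kn k) (n a : ℕ) (v : Pol → ℕ → ℕ) :
    e.weight (n * a) (fun q i => n * v q i) = n * e.weight a v := by
  induction e generalizing v <;> simp_all only [weight, pushWeight_mul, mul_add]

theorem weight_rename {k : Cat} (e : Expr Kp Kn k) (a : ℕ) (v : Pol → ℕ → ℕ)
    (ξ : Pol → ℕ → ℕ) : (e.rename ξ).weight a v = e.weight a (fun q i => v q (ξ q i)) := by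
  induction e generalizing v ξ <;> simp_all only [weight, rename, pushWeight_upRen]

theorem weight_cons {p : Pol} (V : Val Kp Kn p) (s : Sub Kp Kn) (a : ℕ) (v : Pol → ℕ → ℕ) :
    (fun q i => (Sub.cons V s q i).weight a v) =
      pushWeight p (V.weight a v) (fun q i => (s q i).weight a v) := by
  funext q i
  cases p <;> cases q <;> cases i <;> simp [Sub.cons, pushWeight]

/-- The shifted values of `s` do not mention the new variable, so its weight `b` cannot affect them.
Keeping `b` independent of `a` allows a single bound variable to be counted (`a = 0`, `b = 1`). -/
theorem weight_up (p : Pol) (s : Sub Kp Kn) (a b : ℕ) (v : Pol → ℕ → ℕ) :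
    (fun q i => (s.up p q i).weight a (pushWeight p b v)) =
      pushWeight p b (fun q i => (s q i).weight a v) := by
  refine (weight_cons _ _ a _).trans ?_
  simp only [weight_rename, pushWeight_shift]
  simp [weight, pushWeight]

/-- A substituted value contributes its own weight at each occurrence of the variable that it
replaces. -/
theorem weight_subst {k : Cat} (e : Expr Kp Kn k) (a : ℕ) (v : Pol → ℕ → ℕ) (s : Sub Kp Kn) :
    (e.subst s).weight a v = e.weight a (fun q i => (s q i).weight a v) := by
  induction e generalizing v s <;> simp_all only [weight, subst, weight_up]

/-! ### Affinity of the binders and its stability under substitution. -/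

/-- Every bound variable occurs at most once in the scope of its binder. -/
def BindersAffine : {k : Cat} → Expr Kp Kn k → Prop
  | _, .var _ _ => True
  | _, .pair V W => V.BindersAffine ∧ W.BindersAffine
  | _, .brace V => V.BindersAffine
  | _, .kpos _ => True
  | _, .muPair p q c => c.weight 0 (pushWeight q 0 (pushWeight p 1 (fun _ _ => 0))) ≤ 1 ∧
      c.weight 0 (pushWeight q 1 (fun _ _ => 0)) ≤ 1 ∧ c.BindersAffine
  | _, .muBrace p c => c.weight 0 (pushWeight p 1 (fun _ _ => 0)) ≤ 1 ∧ c.BindersAffine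
  | _, .muPos c => c.weight 0 (pushWeight .pos 1 (fun _ _ => 0)) ≤ 1 ∧ c.BindersAffine
  | _, .kneg _ => True
  | _, .ofVal V => V.BindersAffine
  | _, .muNeg c => c.weight 0 (pushWeight .neg 1 (fun _ _ => 0)) ≤ 1 ∧ c.BindersAffine
  | _, .cut t u => t.BindersAffine ∧ u.BindersAffine

theorem BindersAffine.rename {k : Cat} {e : Expr Kp Kn k} (h : e.BindersAffine)
    (ξ : Pol → ℕ → ℕ) : (e.rename ξ).BindersAffine := by
  induction e generalizing ξ <;>
    simp_all only [BindersAffine, Expr.rename, weight_rename, pushWeight_upRen, and_self]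

theorem BindersAffine.cons {p : Pol} {V : Val Kp Kn p} (hV : V.BindersAffine) {s : Sub Kp Kn}
    (hs : ∀ q i, (s q i).BindersAffine) (q : Pol) (i : ℕ) :
    (Sub.cons V s q i).BindersAffine := by
  cases p <;> cases q <;> cases i <;> simp [Sub.cons, hV, hs]

theorem BindersAffine.up {s : Sub Kp Kn} (hs : ∀ q i, (s q i).BindersAffine) (p q : Pol)
    (i : ℕ) : (s.up p q i).BindersAffine :=
  cons (by simp [BindersAffine]) (fun q i => (hs q i).rename _) q i

/-- Values pushed under a binder do not contain its variable, so they weigh `0` when that variable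
is counted and its count in the body is unchanged. Free variables may be duplicated without harm. -/
theorem BindersAffine.subst {k : Cat} {e : Expr Kp Kn k} (h : e.BindersAffine) {s : Sub Kp Kn}
    (hs : ∀ q i, (s q i).BindersAffine) : (e.subst s).BindersAffine := by
  induction e generalizing s with
  | muPair p q c ih =>
    simpa [BindersAffine, Expr.subst, weight_subst, weight_up, weight_zero, h.1, h.2.1] using
      ih h.2.2 (BindersAffine.up (BindersAffine.up hs p) q)
  | _ =>
    simp_all [BindersAffine, Expr.subst, weight_subst, weight_up, weight_zero, BindersAffine.up]

theorem one_le_size {p : Pol} (V : Val Kp Kn p) : 1 ≤ V.size := by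
  cases V <;> simp [size]

/-! ### Growth of the size under substitution. -/

/-- The size after the substitution of `V` for one variable and of variables for the others. -/
theorem size_subst_cons {p : Pol} (c : Cmd Kp Kn) (V : Val Kp Kn p) :
    (c.subst (Sub.cons V (Sub.id Kp Kn))).size =
      c.size + (V.size - 1) * c.weight 0 (pushWeight p 1 (fun _ _ => 0)) := by
  -- This makes the truncated `V.size - 1` exact: the weight `V.size` splits as `1 + (V.size - 1)`,
  -- so that linearity separates the size from the occurrence count.
  have hV := one_le_size V
  rw [← weight_one, weight_subst, weight_cons, weight_one, ← weight_one c, ← weight_mul,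
    ← weight_add]
  congr 1
  funext r i
  cases i <;> by_cases h : r = p <;> simp [pushWeight, h, Sub.id, weight] <;> omega

/-- The size after the simultaneous substitution of `V` and `W` for two variables and of variables
for the others. -/
theorem size_subst_cons_cons {p q : Pol} (c : Cmd Kp Kn) (V : Val Kp Kn p) (W : Val Kp Kn q) :
    (c.subst (Sub.cons W (Sub.cons V (Sub.id Kp Kn)))).size =
      c.size + (V.size - 1) * c.weight 0 (pushWeight q 0 (pushWeight p 1 (fun _ _ => 0))) +
        (W.size - 1) * c.weight 0 (pushWeight q 1 (fun _ _ => 0)) := by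
  have hV := one_le_size V
  have hW := one_le_size W
  rw [← weight_one, weight_subst, weight_cons, weight_cons, weight_one, weight_one,
    ← weight_one c, ← weight_mul, ← weight_mul, ← weight_add, ← weight_add]
  congr 1
  funext r i
  -- Indices `0` and `1` need separate treatment: when `p = q`, they stand for the inner and the
  -- outer variable.
  cases i with
  | zero =>
    by_cases h : r = q <;> by_cases h' : r = p <;> simp [pushWeight, h, h', Sub.id, weight] <;> grind
  | succ i =>
    cases i <;> by_cases h : r = q <;> by_cases h' : r = p <;>
      simp [pushWeight, h, h', Sub.id, weight] <;> grind

end Expr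

/-! ### Decrease of the size along reductions. -/

open MALOmega.Expr

theorem BetaStep.bindersAffine {c d : Cmd Kp Kn} (h : BetaStep c d) (hc : c.BindersAffine) :
    d.BindersAffine := by
  have hid : ∀ q i, (Sub.id Kp Kn q i).BindersAffine := fun _ _ => by
    simp [Sub.id, BindersAffine]
  cases h with
  | brace V c => exact hc.2.2.subst (BindersAffine.cons (V := V) hc.1 hid)
  | pair V W c => exact hc.2.2.2.subst (hc.1.2.cons (hc.1.1.cons hid))

theorem MuStep.bindersAffine {c d : Cmd Kp Kn} (h : MuStep c d) (hc : c.BindersAffine) :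
    d.BindersAffine := by
  have hid : ∀ q i, (Sub.id Kp Kn q i).BindersAffine := fun _ _ => by
    simp [Sub.id, BindersAffine]
  cases h with
  | pos c t => exact hc.1.2.subst (BindersAffine.cons hc.2 hid)
  | neg V c => exact hc.2.2.subst (BindersAffine.cons hc.1 hid)

/-- For one-tuples, the redex has size `|V| + |c| + 2` and the contractum at most `|c| + |V| - 1`;
pairs are similar, with two values. -/
theorem BetaStep.size_lt {c d : Cmd Kp Kn} (h : BetaStep c d) (hc : c.BindersAffine) :
    d.size < c.size := by
  cases h with
  | brace V c =>
    have h₁ := Nat.mul_le_mul_left (V.size - 1) hc.2.1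
    rw [size_subst_cons]
    simp only [size]
    omega
  | pair V W c =>
    have h₁ := Nat.mul_le_mul_left (V.size - 1) hc.2.1
    have h₂ := Nat.mul_le_mul_left (W.size - 1) hc.2.2.1
    rw [size_subst_cons_cons]
    simp only [size]
    omega

theorem MuStep.size_lt {c d : Cmd Kp Kn} (h : MuStep c d) (hc : c.BindersAffine) :
    d.size < c.size := by
  cases h with
  | pos c t =>
    have h₁ := Nat.mul_le_mul_left (t.size - 1) hc.1.1
    rw [size_subst_cons]
    simp only [size]
    omega
  | neg V c =>
    have h₁ := Nat.mul_le_mul_left (V.size - 1) hc.2.1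
    rw [size_subst_cons]
    simp only [size]
    omega

theorem Step.bindersAffine {c d : Cmd Kp Kn} (h : Step c d) (hc : c.BindersAffine) :
    d.BindersAffine :=
  h.elim (·.bindersAffine hc) (·.bindersAffine hc)

theorem Step.size_lt {c d : Cmd Kp Kn} (h : Step c d) (hc : c.BindersAffine) : d.size < c.size :=
  h.elim (·.size_lt hc) (·.size_lt hc)

/-- Each `→_β`-step is paid for by at least one unit of size; `→_μ`-steps only leave slack. -/
theorem Reduces.add_size_le {n : ℕ} {c d : Cmd Kp Kn} (h : Reduces n c d)
    (hc : c.BindersAffine) : n + d.size ≤ c.size := by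
  induction h with
  | refl => simp
  | beta h _ ih =>
    have := ih (h.bindersAffine hc)
    have := h.size_lt hc
    omega
  | mu h _ ih =>
    have := ih (h.bindersAffine hc)
    have := h.size_lt hc
    omega

theorem Expr.BindersAffine.stronglyNormalizing {c : Cmd Kp Kn} (hc : c.BindersAffine) :
    StronglyNormalizing c := by
  induction hn : c.size using Nat.strong_induction_on generalizing c with
  | _ n ih =>
    subst hn
    exact ⟨_, fun d h => ih _ (h.size_lt hc) (h.bindersAffine hc) rfl⟩

theorem StronglyNormalizing.exists_isNormal {c : Cmd Kp Kn} (h : StronglyNormalizing c) :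
    ∃ n d, Reduces n c d ∧ IsNormal d := by
  induction h with
  | intro c _ ih =>
    by_cases hc : IsNormal c
    · exact ⟨0, c, .refl c, hc⟩
    · simp only [IsNormal, not_forall, not_not] at hc
      obtain ⟨d, hd⟩ := hc
      obtain ⟨n, e, hr, he⟩ := ih d hd
      rcases hd with hd | hd
      · exact ⟨n + 1, e, .beta hd hr, he⟩
      · exact ⟨n, e, .mu hd hr, he⟩

/-! ### Typable expressions are affine. -/

/-- Only variables declared in `Γ` are free in `e`, each of them occurs at most once, and so does
every bound variable. -/
def AffineIn {k : Cat} (e : Expr Kp Kn k) (Γ : Ctx) : Prop :=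
  (∀ p i, e.weight 0 (single p i) ≤ if (Γ p i).isSome then 1 else 0) ∧ e.BindersAffine

/-- Only the domain of a context matters, which settles the rules that change formulas or add
declarations. -/
theorem AffineIn.mono {k : Cat} {e : Expr Kp Kn k} {Γ Δ : Ctx} (h : AffineIn e Γ)
    (hΓ : ∀ p i, (Γ p i).isSome → (Δ p i).isSome) : AffineIn e Δ := by
  refine ⟨fun p i => (h.1 p i).trans ?_, h.2⟩
  have := hΓ p i
  grind

theorem Ctx.push_shift (Γ : Ctx) (p q : Pol) (A : Con) (i : ℕ) :
    Γ.push p A q (if q = p then i + 1 else i) = Γ q i := by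
  by_cases h : q = p <;> simp [Ctx.push, h]

theorem AffineIn.weight_pushWeight_zero_le {k : Cat} {e : Expr Kp Kn k} {Γ : Ctx} {p : Pol}
    {A : Con} (h : AffineIn e (Γ.push p A)) (q : Pol) (i : ℕ) :
    e.weight 0 (pushWeight p 0 (single q i)) ≤ if (Γ q i).isSome then 1 else 0 := by
  simpa only [pushWeight_zero_single, Ctx.push_shift] using h.1 q (if q = p then i + 1 else i)

theorem AffineIn.weight_pushWeight_one_le {k : Cat} {e : Expr Kp Kn k} {Γ : Ctx} {p : Pol}
    {A : Con} (h : AffineIn e (Γ.push p A)) :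
    e.weight 0 (pushWeight p 1 (fun _ _ => 0)) ≤ 1 := by
  rw [pushWeight_one_zero]
  exact (h.1 p 0).trans (by split <;> omega)

/-- Disjointness makes one of the two counts vanish; this is where the absence of contraction is
used. -/
theorem add_le_append {Γ Δ : Ctx} (hd : Γ.Disj Δ) {p : Pol} {i m n : ℕ}
    (hm : m ≤ if (Γ p i).isSome then 1 else 0) (hn : n ≤ if (Δ p i).isSome then 1 else 0) :
    m + n ≤ if (Γ.append Δ p i).isSome then 1 else 0 := by
  rcases hd p i with h | h <;> simp_all [Ctx.append]

/-- The expression of a judgment is affine in its context. -/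
def Judgment.Affine : Judgment Kp Kn → Prop
  | .tm t _ Γ => AffineIn t Γ
  | .cmd c Γ => AffineIn c Γ

/-- The induction needs the bound on free variables, since these are the ones that binders capture.
-/
theorem Derivable.affine {J : Judgment Kp Kn} (h : Derivable J) : J.Affine := by
  induction h with
  | ax p i _ =>
    refine ⟨fun q j => ?_, trivial⟩
    by_cases h : q = p ∧ j = i <;> simp [weight, single, Ctx.set, Ctx.empty] <;> grind
  | muNeg _ ih | muPos _ ih | up _ ih =>
    exact ⟨fun q i => ih.weight_pushWeight_zero_le q i, ih.weight_pushWeight_one_le, ih.2⟩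
  | @par p q c A B Γ _ ih =>
    refine ⟨fun r i => ?_, ?_, ih.weight_pushWeight_one_le, ih.2⟩
    -- The index is the one that the outer variable has below the first binder; `ih` accounts for
    -- the second binder.
    · have := ih.weight_pushWeight_zero_le r (if r = p then i + 1 else i)
      rwa [← pushWeight_zero_single, Ctx.push_shift] at this
    -- The variable bound first is a declared variable of `Γ.push p A`, seen from below the second
    -- binder.
    · rw [pushWeight_one_zero]
      exact (ih.weight_pushWeight_zero_le p 0).trans (by split <;> omega)
  | cut hd _ _ ih₁ ih₂ | tensor hd _ _ ih₁ ih₂ =>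
    refine ⟨fun q i => ?_, ih₁.2, ih₂.2⟩
    have h := add_le_append hd (ih₁.1 q i) (ih₂.1 q i)
    exact h
  | down _ ih | ex _ _ _ ih => exact ih
  | all _ ih => exact ih.mono (by simp [Ctx.shift])
  | conv _ _ _ ih => exact ih.mono (by intro q j; simp only [Ctx.set]; split <;> simp)
  | weak _ _ _ ih => exact ih.mono (by intro q j; simp only [Ctx.set]; split <;> simp)

end MALOmega

theorem mainTheorem2 {Kp Kn : Type*} (c : MALOmega.Cmd Kp Kn) (Γ : MALOmega.Ctx)
    (h : MALOmega.Derivable (MALOmega.Judgment.cmd c Γ)) :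
    MALOmega.StronglyNormalizing c ∧
      (∃ (n : ℕ) (d : MALOmega.Cmd Kp Kn),
        n ≤ c.size ∧ MALOmega.Reduces n c d ∧ MALOmega.IsNormal d) ∧
      (∀ (n : ℕ) (d : MALOmega.Cmd Kp Kn), MALOmega.Reduces n c d → n ≤ c.size) := by
  have hc : c.BindersAffine := h.affine.2
  have hle : ∀ n d, MALOmega.Reduces n c d → n ≤ c.size := fun n d hr =>
    (Nat.le_add_right n d.size).trans (hr.add_size_le hc)
  obtain ⟨n, d, hr, hd⟩ := hc.stronglyNormalizing.exists_isNormal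
  exact ⟨hc.stronglyNormalizing, ⟨n, d, hle n d hr, hr, hd⟩, hle⟩
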